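/- Let $\mathcal U_1,\mathcal U_2,\mathcal V$ be finite sets and let $P=P_{U_1,U_2,V}$ and $Q=Q_{U_1,U_2,V}$ be probability distributions on $\mathcal U_1\times\mathcal U_2\times\mathcal V$ with $P\ll Q$. Under hypothesis $H=0$ (resp. $H=1$) the triple $(U_1^n,U_2^n,V^n)$ is i.i.d. with single-letter law $P$ (resp. $Q$). Let $h_1,h_2$ be non-zero reals, $p,\sigma>0$, and consider the multiple-access channel $$Y_i=h_1x_{1,i}+h_2x_{2,i}+Z_i,\qquad i=1,\dots,n,$$ with real inputs, where the $Z_i$ are i.i.d., independent of $(U_1^n,U_2^n,V^n)$, with the generalized Gaussian density $$p_Z(z)=\frac{c_p}{\sigma}e^{-|z|^p/(2\sigma^p)},\qquad c_p=\frac{p}{2^{(p+1)/p}\,\Gamma(1/p)}$$ (for $p=2$ this is the Gaussian law with mean $0$ and variance $\sigma^2$). For $\ell\in\{1,2\}$ let $\Gamma_\ell(n)\ge 0$, $n\ge 1$, be cost budgets with $\Gamma_\ell(n)\to\infty$ and $\Gamma_\ell(n)/n\to 0$ as $n\to\infty$. A scheme of blocklength $n$ consists of encoders $f_\ell:\mathcal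 U_\ell^n\to\mathbb R^n$, $\ell\in\{1,2\}$, such that $\sum_{i=1}^n|x_i|^p\le\Gamma_\ell(n)$ for every $x^n=f_\ell(u_\ell^n)$, $u_\ell^n\in\mathcal U_\ell^n$, and of a measurable guessing function $g:\mathbb R^n\times\mathcal V^n\to\{0,1\}$. With inputs $x_\ell^n=f_\ell(U_\ell^n)$, its error probabilities are $\alpha_n=\mathbb P[g(Y^n,V^n)=1\mid H=0]$ and $\beta_n=\mathbb P[g(Y^n,V^n)=0\mid H=1]$. For $\epsilon\in[0,1)$, an exponent $\theta>0$ is called achievable if there is a sequence of schemes, one for each blocklength $n$, with $\limsup_{n\to\infty}\alpha_n\le\epsilon$ and $\liminf_{n\to\infty}-\frac1n\ln\beta_n\ge\theta$ (where $-\ln 0=+\infty$). Let $\theta^*$ be the supremum of all achievable exponents (with $\theta^*=0$ if there is none). Then, for every $p>0$, every $\epsilon\in[0,1)$ and all such budgets $\Gamma_1,\Gamma_2$, $$\theta^*=D(P_V\|Q_V),$$ where $P_V,Q_V$ are the marginals of $P,Q$ on $\mathcal V$ and $D$ is the Kullback–Leibler divergence (with natural logarithm). -/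

import Mathlib

open MeasureTheory ProbabilityTheory Filter Topology
open scoped ENNReal

noncomputable section

namespace SublinearMAC

/-! ### The general model: distributed testing over a memoryless MAC with input costs -/

section Model

variable {U₁ U₂ V X₁ X₂ Y : Type*} [MeasurableSpace U₁] [MeasurableSpace U₂] [MeasurableSpace V]
  [MeasurableSpace X₁] [MeasurableSpace X₂] [MeasurableSpace Y]

variable (U₁ U₂ V X₁ X₂ Y) in
/-- Encoding functions of the two sensors and guessing function of the decision center,
at blocklength `n`. -/
structure Scheme (n : ℕ) where
  f₁ : (Fin n → U₁) → (Fin n → X₁)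
  f₂ : (Fin n → U₂) → (Fin n → X₂)
  g : (Fin n → Y) × (Fin n → V) → Fin 2
  measurable_g : Measurable g

/-- The block-input cost constraints: every codeword `x^n` of sensor `ℓ` satisfies
`∑ i, c_ℓ (x i) ≤ b_ℓ`. -/
def Scheme.MeetsCost {n : ℕ} (S : Scheme U₁ U₂ V X₁ X₂ Y n)
    (c₁ : X₁ → ℝ) (c₂ : X₂ → ℝ) (b₁ b₂ : ℝ) : Prop :=
  (∀ u, ∑ i, c₁ (S.f₁ u i) ≤ b₁) ∧ (∀ u, ∑ i, c₂ (S.f₂ u i) ≤ b₂)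

/-- Law of the channel output block when the memoryless MAC `W` is fed with `x₁^n`, `x₂^n`. -/
def blockOutput (W : Kernel (X₁ × X₂) Y) {n : ℕ} (x₁ : Fin n → X₁) (x₂ : Fin n → X₂) :
    Measure (Fin n → Y) :=
  Measure.pi fun i => W (x₁ i, x₂ i)

/-- Joint law of `(Y^n, V^n)` when `(U₁^n, U₂^n, V^n)` is i.i.d. with single-letter law `R` and the
sensors send `x_ℓ^n = f_ℓ (u_ℓ^n)` over the memoryless MAC `W`. -/
def Scheme.law {n : ℕ} (S : Scheme U₁ U₂ V X₁ X₂ Y n) (R : Measure (U₁ × U₂ × V))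
    (W : Kernel (X₁ × X₂) Y) : Measure ((Fin n → Y) × (Fin n → V)) :=
  (Measure.pi fun _ : Fin n => R).bind fun u =>
    (blockOutput W (S.f₁ fun i => (u i).1) (S.f₂ fun i => (u i).2.1)).map
      fun y => (y, fun i => (u i).2.2)

/-- Type-I error probability `ℙ[g(Y^n, V^n) = 1 | H = 0]`. -/
def Scheme.typeI {n : ℕ} (S : Scheme U₁ U₂ V X₁ X₂ Y n) (P : Measure (U₁ × U₂ × V))
    (W : Kernel (X₁ × X₂) Y) : ℝ≥0∞ :=
  S.law P W {z | S.g z = 1}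

/-- Type-II error probability `ℙ[g(Y^n, V^n) = 0 | H = 1]`. -/
def Scheme.typeII {n : ℕ} (S : Scheme U₁ U₂ V X₁ X₂ Y n) (Q : Measure (U₁ × U₂ × V))
    (W : Kernel (X₁ × X₂) Y) : ℝ≥0∞ :=
  S.law Q W {z | S.g z = 0}

/-- `θ > 0` is an `(ε, Γ₁, Γ₂)`-achievable type-II error exponent. The logarithm takes values in
`[-∞, ∞]`, so that a vanishing type-II error probability has exponent `+∞`. -/
def IsAchievable (P Q : Measure (U₁ × U₂ × V)) (W : Kernel (X₁ × X₂) Y)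
    (c₁ : X₁ → ℝ) (c₂ : X₂ → ℝ) (Γ₁ Γ₂ : ℕ → ℝ) (ε θ : ℝ) : Prop :=
  0 < θ ∧ ∃ S : (n : ℕ) → Scheme U₁ U₂ V X₁ X₂ Y n,
    (∀ n, 1 ≤ n → (S n).MeetsCost c₁ c₂ (Γ₁ n) (Γ₂ n)) ∧
    limsup (fun n => (S n).typeI P W) atTop ≤ ENNReal.ofReal ε ∧
    (θ : EReal) ≤ liminf (fun n => -ENNReal.log ((S n).typeII Q W) / (n : EReal)) atTop

/-- The Stein exponent: supremum in `[0, ∞]` of all achievable type-II error exponents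
(`0` if there is none). -/
def steinExponent (P Q : Measure (U₁ × U₂ × V)) (W : Kernel (X₁ × X₂) Y)
    (c₁ : X₁ → ℝ) (c₂ : X₂ → ℝ) (Γ₁ Γ₂ : ℕ → ℝ) (ε : ℝ) : ℝ≥0∞ :=
  ⨆ (θ : ℝ) (_ : IsAchievable P Q W c₁ c₂ Γ₁ Γ₂ ε θ), ENNReal.ofReal θ

/-- The marginal law of `V`. -/
def marginalV (R : Measure (U₁ × U₂ × V)) : Measure V :=
  R.map fun u => u.2.2

end Model

/-- Stringent cost budgets: nonnegative, unbounded, and sublinear in the blocklength. -/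
structure IsStringentBudget (Γ : ℕ → ℝ) : Prop where
  nonneg : ∀ n, 1 ≤ n → 0 ≤ Γ n
  tendsto_atTop : Tendsto Γ atTop atTop
  sublinear : Tendsto (fun n : ℕ => Γ n / n) atTop (𝓝 0)

/-! ### The additive MAC with generalized Gaussian noise -/

/-- Density of the generalized Gaussian distribution with parameters `p, σ > 0`. -/
def genGaussianPDF (p σ z : ℝ) : ℝ :=
  p / ((2 : ℝ) ^ ((p + 1) / p) * Real.Gamma (1 / p)) / σ *
    Real.exp (-(|z| ^ p / (2 * σ ^ p)))

/-- The generalized Gaussian distribution with parameters `p, σ > 0`. -/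
def genGaussian (p σ : ℝ) : Measure ℝ :=
  volume.withDensity fun z => ENNReal.ofReal (genGaussianPDF p σ z)

/-- The MAC `Y = h₁ x₁ + h₂ x₂ + Z` with noise law `ν`, independent of the inputs. -/
def additiveMAC (h₁ h₂ : ℝ) (ν : Measure ℝ) [SFinite ν] : Kernel (ℝ × ℝ) ℝ where
  toFun x := ν.map fun z => h₁ * x.1 + h₂ * x.2 + z
  measurable' := by
    refine Measure.measurable_of_measurable_coe _ fun s hs => ?_
    have hm : Measurable fun q : (ℝ × ℝ) × ℝ => h₁ * q.1.1 + h₂ * q.1.2 + q.2 := by fun_prop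
    have h := measurable_measure_prodMk_left (ν := ν) (hm hs)
    convert h using 1
    funext x
    rw [Measure.map_apply (by fun_prop) hs]
    rfl

instance sFinite_genGaussian (p σ : ℝ) : SFinite (genGaussian p σ) := by
  unfold genGaussian; infer_instance

end SublinearMAC

end

/-!
Converse. Since the budgets are sublinear, exchanging two admissible pairs of codewords changes the
output density by at most a factor `exp (o(n))` on the event `∑ i, |y i| ^ p ≤ n * K`, whose
probability is uniformly close to one for large `K`. At the exponential scale the codewords may
therefore be frozen, which makes `Y^n` independent of `V^n` with the same law under both hypotheses.
The likelihood ratio that remains is that of `V^n`, and by the law of large numbers its exponent is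
`D(P_V‖Q_V)`. A type-II error decaying faster would force the type-I error to tend to one.

Achievability. The sensors stay silent and the decision center applies a likelihood-ratio test to
`V^n`.
-/

namespace SublinearMAC

open InformationTheory

/-! ### Product measures -/

section Product

variable {E : Type*} [MeasurableSpace E] {n : ℕ}

lemma lintegral_prod_pi_eq_prod_lintegral (μ : Fin n → Measure E) [∀ i, SigmaFinite (μ i)]
    {f : Fin n → E → ℝ≥0∞} (hf : ∀ i, Measurable (f i)) :
    ∫⁻ x, ∏ i, f i (x i) ∂Measure.pi μ = ∏ i, ∫⁻ x, f i x ∂μ i := by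
  induction n with
  | zero => simp
  | succ n ih =>
    have hsplit := (measurePreserving_piFinSuccAbove μ 0).symm
    have htail : Measurable fun x : Fin n → E ↦ ∏ i, f i.succ (x i) :=
      Finset.measurable_fun_prod _ fun i _ ↦ (hf _).comp (measurable_pi_apply i)
    rw [← hsplit.lintegral_comp (by fun_prop), Fin.prod_univ_succ, ← ih _ fun i ↦ hf _,
      ← lintegral_prod_mul (hf 0).aemeasurable htail.aemeasurable]
    refine lintegral_congr fun x ↦ ?_
    simp [Fin.prod_univ_succ, MeasurableEquiv.piFinSuccAbove, Fin.insertNthEquiv]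

lemma pi_withDensity (μ : Fin n → Measure E) [∀ i, SigmaFinite (μ i)]
    {f : Fin n → E → ℝ≥0∞} (hf : ∀ i, Measurable (f i))
    [∀ i, SigmaFinite ((μ i).withDensity (f i))] :
    Measure.pi (fun i ↦ (μ i).withDensity (f i)) =
      (Measure.pi μ).withDensity fun x ↦ ∏ i, f i (x i) := by
  refine Measure.pi_eq fun s hs ↦ ?_
  rw [withDensity_apply _ (MeasurableSet.univ_pi hs), Measure.restrict_pi_pi,
    lintegral_prod_pi_eq_prod_lintegral _ hf]
  exact Finset.prod_congr rfl fun i _ ↦ (withDensity_apply _ (hs i)).symm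

end Product

lemma restrict_withDensity_le_smul {α : Type*} [MeasurableSpace α] {μ : Measure α}
    {f g : α → ℝ≥0∞} (hg : Measurable g) {s : Set α} (hs : MeasurableSet s) {c : ℝ≥0∞}
    (h : ∀ᵐ x ∂μ, x ∈ s → f x ≤ c * g x) :
    (μ.withDensity f).restrict s ≤ c • μ.withDensity g := by
  rw [restrict_withDensity hs, ← withDensity_smul c hg]
  refine (withDensity_mono ((ae_restrict_iff' hs).2 h)).trans ?_
  rw [← restrict_withDensity hs]
  exact Measure.restrict_le_self

section WeakLaw

variable {E : Type*} [MeasurableSpace E] {μ : Measure E} [IsProbabilityMeasure μ] {f : E → ℝ}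

lemma measurePreserving_infinitePi_comp_val (μ : Measure E) [IsProbabilityMeasure μ] (n : ℕ) :
    MeasurePreserving (fun (x : ℕ → E) (i : Fin n) ↦ x i)
      (Measure.infinitePi fun _ ↦ μ) (Measure.pi fun _ ↦ μ) where
  measurable := by fun_prop
  map_eq := by
    rw [← Measure.infinitePi_eq_pi]
    exact Measure.map_infinitePi_infinitePi_of_inj Fin.val_injective

lemma ae_tendsto_sum_range_div (hf : Measurable f) (hfμ : Integrable f μ) :
    ∀ᵐ x ∂Measure.infinitePi fun _ : ℕ ↦ μ,
      Tendsto (fun n : ℕ ↦ (∑ i ∈ Finset.range n, f (x i)) / n) atTop (𝓝 (∫ x, f x ∂μ)) := by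
  have hcoord := measurePreserving_eval_infinitePi fun _ : ℕ ↦ μ
  have hindep := iIndepFun_infinitePi (P := fun _ : ℕ ↦ μ) (X := fun _ ↦ f) fun _ ↦ hf
  have hident (i : ℕ) : IdentDistrib (fun x : ℕ → E ↦ f (x i)) (fun x ↦ f (x 0))
      (Measure.infinitePi fun _ ↦ μ) (Measure.infinitePi fun _ ↦ μ) :=
    (IdentDistrib.mk (hcoord i).aemeasurable (hcoord 0).aemeasurable
      ((hcoord i).map_eq.trans (hcoord 0).map_eq.symm)).comp hf
  have hmean : ∫ x, f (x 0) ∂(Measure.infinitePi fun _ : ℕ ↦ μ) = ∫ x, f x ∂μ := by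
    conv_rhs => rw [← (hcoord 0).map_eq]
    exact (integral_map (hcoord 0).aemeasurable hf.aestronglyMeasurable).symm
  rw [← hmean]
  exact strong_law_ae_real (fun (i : ℕ) (x : ℕ → E) ↦ f (x i))
    ((hcoord 0).integrable_comp_of_integrable hfμ) (fun i j hij ↦ hindep.indepFun hij) hident

lemma tendsto_measure_pi_mul_le_sum (hf : Measurable f) (hfμ : Integrable f μ) {θ : ℝ}
    (hθ : ∫ x, f x ∂μ < θ) :
    Tendsto (fun n : ℕ ↦ Measure.pi (fun _ : Fin n ↦ μ) {x | n * θ ≤ ∑ i, f (x i)})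
      atTop (𝓝 0) := by
  have hprob := tendstoInMeasure_of_tendsto_ae
    (fun n ↦ (by fun_prop : Measurable fun x : ℕ → E ↦
      (∑ i ∈ Finset.range n, f (x i)) / n).aestronglyMeasurable) (ae_tendsto_sum_range_div hf hfμ)
  refine tendsto_of_tendsto_of_tendsto_of_le_of_le' tendsto_const_nhds
    (hprob (ENNReal.ofReal (θ - ∫ x, f x ∂μ)) (by simpa using hθ)) (by simp) ?_
  filter_upwards [eventually_gt_atTop 0] with n hn
  rw [← (measurePreserving_infinitePi_comp_val μ n).measure_preimage
    (measurableSet_le (by fun_prop) (by fun_prop)).nullMeasurableSet]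
  refine measure_mono fun x hx ↦ ?_
  have hx : θ ≤ (∑ i ∈ Finset.range n, f (x i)) / n := by
    rw [le_div_iff₀' (by positivity), Finset.sum_range]
    exact hx
  rw [Set.mem_ofPred_eq, edist_dist]
  exact ENNReal.ofReal_le_ofReal ((sub_le_sub_right hx _).trans (le_abs_self _))

lemma tendsto_measure_pi_sum_le_mul (hf : Measurable f) (hfμ : Integrable f μ) {θ : ℝ}
    (hθ : θ < ∫ x, f x ∂μ) :
    Tendsto (fun n : ℕ ↦ Measure.pi (fun _ : Fin n ↦ μ) {x | ∑ i, f (x i) ≤ n * θ})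
      atTop (𝓝 0) := by
  simpa only [Pi.neg_apply, mul_neg, Finset.sum_neg_distrib, neg_le_neg_iff] using
    tendsto_measure_pi_mul_le_sum (θ := -θ) hf.neg hfμ.neg
      (by simpa only [Pi.neg_apply, integral_neg, neg_lt_neg_iff] using hθ)

end WeakLaw

/-! ### Stein's lemma for an i.i.d. source -/

section Truncation

variable {α : Type*} [MeasurableSpace α] {μ : Measure α} {f : α → ℝ}

lemma tendsto_min_natCast (x : ℝ) : Tendsto (fun M : ℕ ↦ min x M) atTop (𝓝 x) :=
  tendsto_const_nhds.congr' ((eventually_ge_atTop ⌈x⌉₊).mono fun _ hM ↦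
    (min_eq_left (Nat.ceil_le.1 hM)).symm)

lemma abs_min_le_sub (x : ℝ) {M : ℝ} (hM : 0 ≤ M) : |min x M| ≤ min x M - 2 * min x 0 := by
  rcases le_total x 0 with hx | hx
  · rw [min_eq_left hx, min_eq_left (hx.trans hM), abs_of_nonpos hx]
    linarith
  · rw [min_eq_right hx, abs_of_nonneg (le_min hx hM)]
    linarith

lemma integrable_of_forall_integral_min_le {c : ℝ}
    (hmin : ∀ M : ℕ, Integrable (fun x ↦ min (f x) M) μ) (hc : ∀ M : ℕ, ∫ x, min (f x) M ∂μ ≤ c) :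
    Integrable f μ := by
  have hlim : ∀ x, Tendsto (fun M : ℕ ↦ min (f x) M) atTop (𝓝 (f x)) :=
    fun x ↦ tendsto_min_natCast (f x)
  have hbound (M : ℕ) : ∫⁻ x, ‖min (f x) M‖ₑ ∂μ ≤
      ENNReal.ofReal (c - 2 * ∫ x, min (f x) (0 : ℕ) ∂μ) := by
    rw [← ofReal_integral_norm_eq_lintegral_enorm (hmin M)]
    refine ENNReal.ofReal_le_ofReal ?_
    calc ∫ x, ‖min (f x) M‖ ∂μ ≤ ∫ x, (min (f x) M - 2 * min (f x) (0 : ℕ)) ∂μ :=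
          integral_mono (hmin M).norm ((hmin M).sub ((hmin 0).const_mul 2))
            fun x ↦ by simpa using abs_min_le_sub (f x) M.cast_nonneg
      _ = ∫ x, min (f x) M ∂μ - 2 * ∫ x, min (f x) (0 : ℕ) ∂μ := by
          rw [integral_sub (hmin M) ((hmin 0).const_mul 2), integral_const_mul]
      _ ≤ c - 2 * ∫ x, min (f x) (0 : ℕ) ∂μ := sub_le_sub_right (hc M) _
  refine ⟨aestronglyMeasurable_of_tendsto_ae atTop (fun M ↦ (hmin M).aestronglyMeasurable)
    (ae_of_all _ hlim), ?_⟩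
  calc ∫⁻ x, ‖f x‖ₑ ∂μ ≤ liminf (fun M : ℕ ↦ ∫⁻ x, ‖min (f x) M‖ₑ ∂μ) atTop :=
        (lintegral_congr fun x ↦ (hlim x).enorm.liminf_eq.symm).trans_le
          (lintegral_liminf_le' fun M ↦ (hmin M).aestronglyMeasurable.enorm)
    _ ≤ ENNReal.ofReal (c - 2 * ∫ x, min (f x) (0 : ℕ) ∂μ) :=
        liminf_le_of_frequently_le' (Frequently.of_forall hbound)
    _ < ∞ := ENNReal.ofReal_lt_top

lemma tendsto_integral_min_natCast (hf : Integrable f μ)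
    (hmin : ∀ M : ℕ, Integrable (fun x ↦ min (f x) M) μ) :
    Tendsto (fun M : ℕ ↦ ∫ x, min (f x) M ∂μ) atTop (𝓝 (∫ x, f x ∂μ)) :=
  integral_tendsto_of_tendsto_of_monotone hmin hf
    (ae_of_all _ fun x _ _ hMN ↦ min_le_min_left (f x) (Nat.cast_le.2 hMN))
    (ae_of_all _ fun x ↦ tendsto_min_natCast (f x))

end Truncation

section LikelihoodRatio

variable {E : Type*} [MeasurableSpace E] {μ ν : Measure E}

lemma pi_eq_withDensity_prod_rnDeriv [SigmaFinite μ] [SigmaFinite ν] (hμν : μ ≪ ν) (n : ℕ) :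
    Measure.pi (fun _ : Fin n ↦ μ) =
      (Measure.pi fun _ ↦ ν).withDensity fun v ↦ ∏ i, μ.rnDeriv ν (v i) := by
  have hdens : ν.withDensity (μ.rnDeriv ν) = μ := Measure.withDensity_rnDeriv_eq μ ν hμν
  have (_ : Fin n) : SigmaFinite (ν.withDensity (μ.rnDeriv ν)) := by
    rw [hdens]
    infer_instance
  rw [← pi_withDensity _ fun _ ↦ Measure.measurable_rnDeriv μ ν, hdens]

lemma restrict_pi_sum_llr_le_smul [SigmaFinite μ] [SigmaFinite ν] (hμν : μ ≪ ν) (n : ℕ) (a : ℝ) :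
    (Measure.pi fun _ : Fin n ↦ μ).restrict {v | ∑ i, llr μ ν (v i) ≤ a} ≤
      ENNReal.ofReal (Real.exp a) • Measure.pi fun _ ↦ ν := by
  have hfinite : ∀ᵐ v ∂Measure.pi fun _ : Fin n ↦ ν, ∀ i, μ.rnDeriv ν (v i) < ∞ :=
    eventually_all.2 fun i ↦
      (Measure.tendsto_eval_ae_ae (μ := fun _ ↦ ν) (i := i)).eventually (μ.rnDeriv_lt_top ν)
  have hllr : Measurable fun v : Fin n → E ↦ ∑ i, llr μ ν (v i) :=
    Finset.measurable_fun_sum _ fun i _ ↦ (measurable_llr μ ν).comp (measurable_pi_apply i)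
  rw [pi_eq_withDensity_prod_rnDeriv hμν]
  refine (restrict_withDensity_le_smul measurable_one (measurableSet_le hllr measurable_const)
    (hfinite.mono fun v hv (hsum : ∑ i, llr μ ν (v i) ≤ a) ↦ ?_)).trans_eq
      (by rw [withDensity_one])
  rw [Pi.one_apply, mul_one]
  calc ∏ i, μ.rnDeriv ν (v i)
      ≤ ∏ i, ENNReal.ofReal (Real.exp (llr μ ν (v i))) := by
        gcongr with i
        rw [← ENNReal.ofReal_toReal (hv i).ne]
        exact ENNReal.ofReal_le_ofReal (Real.le_exp_log _)
    _ = ENNReal.ofReal (Real.exp (∑ i, llr μ ν (v i))) := by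
        rw [Real.exp_sum, ENNReal.ofReal_prod_of_nonneg fun _ _ ↦ Real.exp_nonneg _]
    _ ≤ ENNReal.ofReal (Real.exp a) := ENNReal.ofReal_le_ofReal (Real.exp_le_exp.2 hsum)

lemma exists_restrict_pi_le_smul_of_klDiv_lt [IsProbabilityMeasure μ] [IsProbabilityMeasure ν]
    {θ : ℝ} (hθ : klDiv μ ν < ENNReal.ofReal θ) :
    ∃ T : ∀ n, Set (Fin n → E), (∀ n, MeasurableSet (T n)) ∧
      Tendsto (fun n ↦ Measure.pi (fun _ ↦ μ) (T n)ᶜ) atTop (𝓝 0) ∧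
      ∀ n : ℕ, (Measure.pi fun _ ↦ μ).restrict (T n) ≤
        ENNReal.ofReal (Real.exp (n * θ)) • Measure.pi fun _ ↦ ν := by
  obtain ⟨hμν, hint⟩ := klDiv_ne_top_iff.1 hθ.ne_top
  have hmean : ∫ x, llr μ ν x ∂μ < θ := by
    rw [← toReal_klDiv_of_measure_eq hμν (by simp)]
    exact ENNReal.toReal_lt_of_lt_ofReal hθ
  have hllr := measurable_llr μ ν
  refine ⟨fun n ↦ {v | ∑ i, llr μ ν (v i) ≤ n * θ},
    fun n ↦ measurableSet_le (by fun_prop) measurable_const, ?_,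
    fun n ↦ restrict_pi_sum_llr_le_smul hμν n _⟩
  refine tendsto_of_tendsto_of_tendsto_of_le_of_le tendsto_const_nhds
    (tendsto_measure_pi_mul_le_sum hllr hint hmean) (fun _ ↦ zero_le) fun n ↦
    measure_mono fun v (hv : ¬ ∑ i, llr μ ν (v i) ≤ n * θ) ↦ (not_le.1 hv).le

end LikelihoodRatio

section Chernoff

variable {E : Type*} [MeasurableSpace E] {μ ν : Measure E} [IsProbabilityMeasure μ]

/-- A pair of functions certifying, by Markov's inequality and the weak law of large numbers, that
`ν` is exponentially separated from `μ` at every rate below the `μ`-mean of `f`. When `μ ≪ ν` one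
takes for `g` the likelihood ratio and for `f` a truncation of its logarithm. -/
structure IsChernoffPair (μ ν : Measure E) (g : E → ℝ≥0∞) (f : E → ℝ) : Prop where
  measurable_left : Measurable g
  measurable_right : Measurable f
  lintegral_le_one : ∫⁻ x, g x ∂ν ≤ 1
  integrable : Integrable f μ
  exp_le : ∀ᵐ x ∂μ, ENNReal.ofReal (Real.exp (f x)) ≤ g x

lemma IsChernoffPair.tendsto_measure_pi_prod_lt {g : E → ℝ≥0∞} {f : E → ℝ}
    (h : IsChernoffPair μ ν g f) {θ : ℝ} (hθ : θ < ∫ x, f x ∂μ) :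
    Tendsto (fun n : ℕ ↦ Measure.pi (fun _ : Fin n ↦ μ)
      {v | ∏ i, g (v i) < ENNReal.ofReal (Real.exp (n * θ))}) atTop (𝓝 0) := by
  refine tendsto_of_tendsto_of_tendsto_of_le_of_le tendsto_const_nhds
    (tendsto_measure_pi_sum_le_mul h.measurable_right h.integrable hθ) (fun _ ↦ zero_le)
    fun n ↦ measure_mono_ae ?_
  have hcoord : ∀ᵐ v ∂Measure.pi fun _ : Fin n ↦ μ,
      ∀ i, ENNReal.ofReal (Real.exp (f (v i))) ≤ g (v i) :=
    eventually_all.2 fun i ↦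
      (Measure.tendsto_eval_ae_ae (μ := fun _ ↦ μ) (i := i)).eventually h.exp_le
  filter_upwards [hcoord] with v hv (hlt : ∏ i, g (v i) < _)
  have hexp : ENNReal.ofReal (Real.exp (∑ i, f (v i))) ≤ ∏ i, g (v i) := by
    rw [Real.exp_sum, ENNReal.ofReal_prod_of_nonneg fun _ _ ↦ Real.exp_nonneg _]
    exact Finset.prod_le_prod' fun i _ ↦ hv i
  have := (ENNReal.ofReal_lt_ofReal_iff (Real.exp_pos _)).1 (hexp.trans_lt hlt)
  exact (Real.exp_lt_exp.1 this).le

variable [IsProbabilityMeasure ν]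

lemma measure_pi_prod_ge_le {g : E → ℝ≥0∞} (hg : Measurable g) (hgν : ∫⁻ x, g x ∂ν ≤ 1) (n : ℕ)
    (a : ℝ) : Measure.pi (fun _ : Fin n ↦ ν) {v | ENNReal.ofReal (Real.exp a) ≤ ∏ i, g (v i)} ≤
      ENNReal.ofReal (Real.exp (-a)) := by
  have hprod : Measurable fun v : Fin n → E ↦ ∏ i, g (v i) := by fun_prop
  calc _ ≤ (∫⁻ v, ∏ i, g (v i) ∂Measure.pi fun _ : Fin n ↦ ν) / ENNReal.ofReal (Real.exp a) :=
        meas_ge_le_lintegral_div hprod.aemeasurable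
          (ENNReal.ofReal_pos.2 (Real.exp_pos a)).ne' ENNReal.ofReal_ne_top
    _ ≤ 1 / ENNReal.ofReal (Real.exp a) := by
        rw [lintegral_prod_pi_eq_prod_lintegral _ fun _ ↦ hg]
        gcongr
        exact Finset.prod_le_one' fun _ _ ↦ hgν
    _ = ENNReal.ofReal (Real.exp (-a)) := by
        rw [one_div, Real.exp_neg, ENNReal.ofReal_inv_of_pos (Real.exp_pos a)]

lemma exists_isChernoffPair_of_not_ac (hμν : ¬ μ ≪ ν) (θ : ℝ) :
    ∃ g f, IsChernoffPair μ ν g f ∧ θ < ∫ x, f x ∂μ := by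
  obtain ⟨A, hA, hνA, hμA⟩ : ∃ A, MeasurableSet A ∧ ν A = 0 ∧ μ A ≠ 0 := by
    by_contra! h
    exact hμν (Measure.AbsolutelyContinuous.mk fun s hs ↦ h s hs)
  have hpos : 0 < μ.real A := ENNReal.toReal_pos hμA (measure_ne_top μ A)
  let f : E → ℝ := A.indicator fun _ ↦ (|θ| + 1) / μ.real A
  have hf : Measurable f := measurable_const.indicator hA
  have hone : (fun x ↦ ENNReal.ofReal (Real.exp (f x))) =ᵐ[ν] fun _ ↦ 1 := by
    filter_upwards [measure_eq_zero_iff_ae_notMem.1 hνA] with x hx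
    simp [f, hx]
  refine ⟨fun x ↦ ENNReal.ofReal (Real.exp (f x)), f,
    ⟨by fun_prop, hf, ?_, (integrable_const _).indicator hA, ae_of_all _ fun _ ↦ le_rfl⟩, ?_⟩
  · simp [lintegral_congr_ae hone]
  · rw [integral_indicator_const _ hA, smul_eq_mul, mul_div_cancel₀ _ hpos.ne']
    linarith [le_abs_self θ]

lemma integrable_min_llr (hμν : μ ≪ ν) (M : ℝ) : Integrable (fun x ↦ min (llr μ ν x) M) μ := by
  have hinv : Integrable (fun x ↦ (ν.rnDeriv μ x).toReal) μ := Measure.integrable_toReal_rnDeriv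
  refine (hinv.add (integrable_const |M|)).mono'
    ((measurable_llr μ ν).min measurable_const).aestronglyMeasurable ?_
  filter_upwards [exp_neg_llr hμν] with x hx
  rw [Pi.add_apply, ← hx, Real.norm_eq_abs, abs_le]
  have := Real.add_one_le_exp (-llr μ ν x)
  have := Real.exp_pos (-llr μ ν x)
  have := abs_le.1 (le_refl |M|)
  constructor
  · exact le_min (by linarith) (by linarith)
  · exact (min_le_right _ _).trans (by linarith)

lemma isChernoffPair_rnDeriv_min_llr (hμν : μ ≪ ν) (M : ℝ) :
    IsChernoffPair μ ν (μ.rnDeriv ν) fun x ↦ min (llr μ ν x) M where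
  measurable_left := Measure.measurable_rnDeriv μ ν
  measurable_right := (measurable_llr μ ν).min measurable_const
  lintegral_le_one := Measure.lintegral_rnDeriv_le.trans_eq measure_univ
  integrable := integrable_min_llr hμν M
  exp_le := by
    filter_upwards [exp_llr_of_ac μ ν hμν] with x hx
    calc ENNReal.ofReal (Real.exp (min (llr μ ν x) M))
        ≤ ENNReal.ofReal (Real.exp (llr μ ν x)) :=
          ENNReal.ofReal_le_ofReal (Real.exp_le_exp.2 (min_le_left _ _))
      _ ≤ μ.rnDeriv ν x := by rw [hx]; exact ENNReal.ofReal_toReal_le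

lemma exists_isChernoffPair_of_lt_klDiv {θ : ℝ} (hθ : ENNReal.ofReal θ < klDiv μ ν) :
    ∃ g f, IsChernoffPair μ ν g f ∧ θ < ∫ x, f x ∂μ := by
  by_cases hμν : μ ≪ ν
  · by_contra! h
    have hmean (M : ℕ) : ∫ x, min (llr μ ν x) M ∂μ ≤ θ :=
      h _ _ (isChernoffPair_rnDeriv_min_llr hμν M)
    have hmin (M : ℕ) := integrable_min_llr hμν M
    have hint := integrable_of_forall_integral_min_le hmin hmean
    have hle : ∫ x, llr μ ν x ∂μ ≤ θ :=
      le_of_tendsto' (tendsto_integral_min_natCast hint hmin) hmean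
    rw [← ENNReal.ofReal_toReal (klDiv_ne_top hμν hint),
      toReal_klDiv_of_measure_eq hμν (by simp)] at hθ
    exact hθ.not_ge (ENNReal.ofReal_le_ofReal hle)
  · exact exists_isChernoffPair_of_not_ac hμν θ

lemma exists_measure_pi_le_exp_of_lt_klDiv {θ : ℝ} (hθ : ENNReal.ofReal θ < klDiv μ ν) :
    ∃ T : ∀ n, Set (Fin n → E), (∀ n, MeasurableSet (T n)) ∧
      Tendsto (fun n ↦ Measure.pi (fun _ ↦ μ) (T n)ᶜ) atTop (𝓝 0) ∧
      ∀ n : ℕ, Measure.pi (fun _ ↦ ν) (T n) ≤ ENNReal.ofReal (Real.exp (-(n * θ))) := by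
  obtain ⟨g, f, hgf, hmean⟩ := exists_isChernoffPair_of_lt_klDiv hθ
  have hg := hgf.measurable_left
  refine ⟨fun n ↦ {v | ENNReal.ofReal (Real.exp (n * θ)) ≤ ∏ i, g (v i)},
    fun n ↦ measurableSet_le measurable_const (by fun_prop), ?_,
    fun n ↦ measure_pi_prod_ge_le hg hgf.lintegral_le_one n _⟩
  simpa only [Set.compl_ofPred, not_le] using hgf.tendsto_measure_pi_prod_lt hmean

end Chernoff

/-! ### The law of the observations -/

lemma coe_le_neg_log_div_iff {θ : ℝ} {β : ℝ≥0∞} {n : ℕ} (hn : 0 < n) :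
    (θ : EReal) ≤ -ENNReal.log β / (n : EReal) ↔ β ≤ ENNReal.ofReal (Real.exp (-(n * θ))) := by
  rw [EReal.le_div_iff_mul_le (by exact_mod_cast hn) (EReal.natCast_ne_top n), EReal.le_neg,
    ← ENNReal.log_le_log_iff, ENNReal.log_ofReal_of_pos (Real.exp_pos _), Real.log_exp,
    mul_comm (n : ℝ)]
  rfl

section ObservationLaw

variable {U₁ U₂ V X₁ X₂ Y : Type*} [MeasurableSpace U₁] [MeasurableSpace U₂] [MeasurableSpace V]
  [MeasurableSpace X₁] [MeasurableSpace X₂] [MeasurableSpace Y]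
  {R : Measure (U₁ × U₂ × V)} {W : Kernel (X₁ × X₂) Y} [IsMarkovKernel W]
  {n : ℕ}

instance isProbabilityMeasure_marginalV [IsProbabilityMeasure R] :
    IsProbabilityMeasure (marginalV R) :=
  Measure.isProbabilityMeasure_map (by fun_prop)

instance isProbabilityMeasure_blockOutput (x₁ : Fin n → X₁) (x₂ : Fin n → X₂) :
    IsProbabilityMeasure (blockOutput W x₁ x₂) := by
  unfold blockOutput
  infer_instance

lemma measurePreserving_pi_snd_snd (R : Measure (U₁ × U₂ × V)) [IsProbabilityMeasure R] (n : ℕ) :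
    MeasurePreserving (fun (u : Fin n → U₁ × U₂ × V) i ↦ (u i).2.2)
      (Measure.pi fun _ ↦ R) (Measure.pi fun _ ↦ marginalV R) :=
  measurePreserving_pi (f := fun _ (u : U₁ × U₂ × V) ↦ u.2.2) _ _ fun _ ↦ ⟨by fun_prop, rfl⟩

namespace Scheme

/-- Conditional law of the channel output block `Y^n` given the source block `u`. -/
noncomputable def outputGiven (S : Scheme U₁ U₂ V X₁ X₂ Y n) (W : Kernel (X₁ × X₂) Y)
    (u : Fin n → U₁ × U₂ × V) : Measure (Fin n → Y) :=
  blockOutput W (S.f₁ fun i ↦ (u i).1) (S.f₂ fun i ↦ (u i).2.1)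

instance isProbabilityMeasure_outputGiven (S : Scheme U₁ U₂ V X₁ X₂ Y n)
    (u : Fin n → U₁ × U₂ × V) : IsProbabilityMeasure (S.outputGiven W u) :=
  isProbabilityMeasure_blockOutput _ _

variable [Countable U₁] [MeasurableSingletonClass U₁] [Countable U₂] [MeasurableSingletonClass U₂]
  (S : Scheme U₁ U₂ V X₁ X₂ Y n) {s : Set ((Fin n → Y) × (Fin n → V))} {G : Set (Fin n → Y)}
  {b : ℝ≥0∞}

lemma measurable_outputGiven_section (hs : MeasurableSet s) :
    Measurable fun u ↦ S.outputGiven W u ((fun y ↦ (y, fun i ↦ (u i).2.2)) ⁻¹' s) := by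
  have h : Measurable fun q : ((Fin n → U₁) × (Fin n → U₂)) × (Fin n → V) ↦
      blockOutput W (S.f₁ q.1.1) (S.f₂ q.1.2) ((fun y ↦ (y, q.2)) ⁻¹' s) :=
    measurable_from_prod_countable_right fun x ↦
      measurable_measure_prodMk_right (μ := blockOutput W (S.f₁ x.1) (S.f₂ x.2)) hs
  exact h.comp (f := fun u : Fin n → U₁ × U₂ × V ↦
    ((fun i ↦ (u i).1, fun i ↦ (u i).2.1), fun i ↦ (u i).2.2)) (by fun_prop)

lemma law_apply (hs : MeasurableSet s) :
    S.law R W s = ∫⁻ u, S.outputGiven W u ((fun y ↦ (y, fun i ↦ (u i).2.2)) ⁻¹' s)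
      ∂Measure.pi fun _ ↦ R := by
  have happly (u : Fin n → U₁ × U₂ × V) {t : Set ((Fin n → Y) × (Fin n → V))}
      (ht : MeasurableSet t) :
      (S.outputGiven W u).map (fun y ↦ (y, fun i ↦ (u i).2.2)) t =
        S.outputGiven W u ((fun y ↦ (y, fun i ↦ (u i).2.2)) ⁻¹' t) :=
    Measure.map_apply (by fun_prop) ht
  have hmeas : Measurable fun u ↦ (S.outputGiven W u).map fun y ↦ (y, fun i ↦ (u i).2.2) :=
    Measure.measurable_of_measurable_coe _ fun t ht ↦ by
      simpa only [happly _ ht] using S.measurable_outputGiven_section ht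
  exact (Measure.bind_apply hs hmeas.aemeasurable).trans (lintegral_congr fun u ↦ happly u hs)

lemma law_le_mul_law (S S' : Scheme U₁ U₂ V X₁ X₂ Y n)
    (h : ∀ u, (S.outputGiven W u).restrict G ≤ b • S'.outputGiven W u) (hs : MeasurableSet s)
    (hsG : s ⊆ Prod.fst ⁻¹' G) : S.law R W s ≤ b * S'.law R W s := by
  rw [S.law_apply hs, S'.law_apply hs,
    ← lintegral_const_mul b (S'.measurable_outputGiven_section hs)]
  refine lintegral_mono fun u ↦ ?_
  have hsub : (fun y ↦ (y, fun i ↦ (u i).2.2)) ⁻¹' s ⊆ G := fun y hy ↦ hsG hy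
  rw [← Measure.restrict_eq_self (S.outputGiven W u) hsub]
  exact h u _

variable [IsProbabilityMeasure R]

lemma law_snd_preimage {T : Set (Fin n → V)} (hT : MeasurableSet T) :
    S.law R W (Prod.snd ⁻¹' T) = Measure.pi (fun _ ↦ marginalV R) T := by
  have hind (u : Fin n → U₁ × U₂ × V) :
      S.outputGiven W u ((fun y ↦ (y, fun i ↦ (u i).2.2)) ⁻¹' (Prod.snd ⁻¹' T)) =
        ((fun (u : Fin n → U₁ × U₂ × V) i ↦ (u i).2.2) ⁻¹' T).indicator 1 u := by
    by_cases hu : (fun i ↦ (u i).2.2) ∈ T <;> simp [Set.preimage, hu]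
  rw [S.law_apply (measurable_snd hT), lintegral_congr hind,
    lintegral_indicator_one ((measurePreserving_pi_snd_snd R n).measurable hT),
    (measurePreserving_pi_snd_snd R n).measure_preimage hT.nullMeasurableSet]

lemma law_univ : S.law R W Set.univ = 1 := by
  simpa using S.law_snd_preimage (R := R) (W := W) MeasurableSet.univ

lemma law_fst_preimage_le {η : ℝ≥0∞} (hG : MeasurableSet G) (h : ∀ u, S.outputGiven W u G ≤ η) :
    S.law R W (Prod.fst ⁻¹' G) ≤ η := by
  rw [S.law_apply (measurable_fst hG)]
  exact (lintegral_mono h).trans (by simp)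

/-- The scheme whose encoders ignore the sources and always send the words `x₁`, `x₂`. -/
def constant (x₁ : Fin n → X₁) (x₂ : Fin n → X₂) (g : (Fin n → Y) × (Fin n → V) → Fin 2)
    (hg : Measurable g) : Scheme U₁ U₂ V X₁ X₂ Y n :=
  ⟨fun _ ↦ x₁, fun _ ↦ x₂, g, hg⟩

lemma law_constant (x₁ : Fin n → X₁) (x₂ : Fin n → X₂)
    {g : (Fin n → Y) × (Fin n → V) → Fin 2} (hg : Measurable g) :
    (constant x₁ x₂ g hg).law R W =
      (blockOutput W x₁ x₂).prod (Measure.pi fun _ ↦ marginalV R) := by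
  ext s hs
  rw [law_apply _ hs, Measure.prod_apply_symm hs,
    ← (measurePreserving_pi_snd_snd R n).lintegral_comp (measurable_measure_prodMk_right hs)]
  rfl

end Scheme

end ObservationLaw

lemma prod_apply_le_mul_of_restrict_le_smul {α β : Type*} [MeasurableSpace α] [MeasurableSpace β]
    (ρ : Measure α) {μ ν : Measure β} [SFinite μ] [SFinite ν] {T : Set β} {L : ℝ≥0∞}
    (h : μ.restrict T ≤ L • ν) {s : Set (α × β)} (hs : MeasurableSet s) (hsT : s ⊆ Prod.snd ⁻¹' T) :
    ρ.prod μ s ≤ L * ρ.prod ν s := by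
  rw [Measure.prod_apply hs, Measure.prod_apply hs,
    ← lintegral_const_mul L (measurable_measure_prodMk_left hs)]
  refine lintegral_mono fun a ↦ ?_
  have hsub : Prod.mk a ⁻¹' s ⊆ T := fun _ hb ↦ hsT hb
  rw [← Measure.restrict_eq_self μ hsub]
  exact h _

section Stein

variable {U₁ U₂ V X₁ X₂ Y : Type*} [Countable U₁] [MeasurableSpace U₁]
  [MeasurableSingletonClass U₁] [Countable U₂] [MeasurableSpace U₂] [MeasurableSingletonClass U₂]
  [MeasurableSpace V] [MeasurableSpace X₁] [MeasurableSpace X₂] [MeasurableSpace Y]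
  {P Q : Measure (U₁ × U₂ × V)} [IsProbabilityMeasure P] [IsProbabilityMeasure Q]
  {W : Kernel (X₁ × X₂) Y} [IsMarkovKernel W] {c₁ : X₁ → ℝ} {c₂ : X₂ → ℝ} {Γ₁ Γ₂ : ℕ → ℝ} {ε θ : ℝ}

/-! ### Converse -/

namespace Scheme

variable {n : ℕ} (S : Scheme U₁ U₂ V X₁ X₂ Y n) {G : Set (Fin n → Y)} {T : Set (Fin n → V)}
  {b L η : ℝ≥0∞}

/- The change of measure passes through the law obtained by freezing the codewords of one source
block, under which `Y^n` and `V^n` are independent. -/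
lemma law_le_mul_law_of_restrict_le_smul
    (hb : ∀ u u', (S.outputGiven W u).restrict G ≤ b • S.outputGiven W u')
    (hL : (Measure.pi fun _ ↦ marginalV P).restrict T ≤ L • Measure.pi fun _ ↦ marginalV Q)
    {s : Set ((Fin n → Y) × (Fin n → V))} (hs : MeasurableSet s) (hsG : s ⊆ Prod.fst ⁻¹' G)
    (hsT : s ⊆ Prod.snd ⁻¹' T) : S.law P W s ≤ b * (L * (b * S.law Q W s)) := by
  have := P.nonempty_of_neZero
  let u₀ : Fin n → U₁ × U₂ × V := Classical.arbitrary _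
  let S₀ : Scheme U₁ U₂ V X₁ X₂ Y n :=
    constant (S.f₁ fun i ↦ (u₀ i).1) (S.f₂ fun i ↦ (u₀ i).2.1) S.g S.measurable_g
  calc S.law P W s ≤ b * S₀.law P W s := law_le_mul_law S S₀ (fun u ↦ hb u u₀) hs hsG
    _ ≤ b * (L * S₀.law Q W s) := by
        rw [law_constant, law_constant]
        gcongr
        exact prod_apply_le_mul_of_restrict_le_smul _ hL hs hsT
    _ ≤ b * (L * (b * S.law Q W s)) := by
        gcongr
        exact law_le_mul_law S₀ S (hb u₀) hs hsG

lemma one_le_typeI_add_mul_typeII (hG : MeasurableSet G) (hT : MeasurableSet T)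
    (hη : ∀ u, S.outputGiven W u Gᶜ ≤ η)
    (hb : ∀ u u', (S.outputGiven W u).restrict G ≤ b • S.outputGiven W u')
    (hL : (Measure.pi fun _ ↦ marginalV P).restrict T ≤ L • Measure.pi fun _ ↦ marginalV Q) :
    1 ≤ S.typeI P W + b * (L * (b * S.typeII Q W)) + η +
      Measure.pi (fun _ ↦ marginalV P) Tᶜ := by
  let A : Set ((Fin n → Y) × (Fin n → V)) := {z | S.g z = 0}
  have hA : MeasurableSet A := S.measurable_g (measurableSet_singleton 0)
  let C := A ∩ (Prod.fst ⁻¹' G ∩ Prod.snd ⁻¹' T)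
  have hC : MeasurableSet C := hA.inter ((measurable_fst hG).inter (measurable_snd hT))
  have hcover : Set.univ ⊆ {z | S.g z = 1} ∪ C ∪ Prod.fst ⁻¹' Gᶜ ∪ Prod.snd ⁻¹' Tᶜ := by
    intro z _
    have : S.g z = 0 ∨ S.g z = 1 := by omega
    simp only [C, A, Set.mem_union, Set.mem_inter_iff, Set.mem_preimage, Set.mem_compl_iff,
      Set.mem_ofPred_eq]
    tauto
  calc (1 : ℝ≥0∞) = S.law P W Set.univ := S.law_univ.symm
    _ ≤ S.law P W {z | S.g z = 1} + S.law P W C + S.law P W (Prod.fst ⁻¹' Gᶜ) +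
          S.law P W (Prod.snd ⁻¹' Tᶜ) := by
        refine (measure_mono hcover).trans ((measure_union_le _ _).trans ?_)
        gcongr
        refine (measure_union_le _ _).trans ?_
        gcongr
        exact measure_union_le _ _
    _ ≤ S.typeI P W + b * (L * (b * S.typeII Q W)) + η +
          Measure.pi (fun _ ↦ marginalV P) Tᶜ := by
        rw [S.law_snd_preimage hT.compl]
        gcongr
        · exact le_rfl
        · refine (S.law_le_mul_law_of_restrict_le_smul hb hL hC (fun _ hz ↦ hz.2.1)
            fun _ hz ↦ hz.2.2).trans ?_
          gcongr
          exact measure_mono Set.inter_subset_left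
        · exact S.law_fst_preimage_le hG.compl hη

end Scheme

/-- The channel reveals nothing on the exponential scale about admissible codewords: off an
event of small probability, any two admissible pairs of codewords produce output blocks whose
likelihood ratio is subexponential in the blocklength. -/
def IsAsymptoticallyBlind (W : Kernel (X₁ × X₂) Y) (c₁ : X₁ → ℝ) (c₂ : X₂ → ℝ) (Γ₁ Γ₂ : ℕ → ℝ) :
    Prop :=
  ∀ δ : ℝ, 0 < δ → ∀ η : ℝ≥0∞, 0 < η → ∀ᶠ n : ℕ in atTop,
    ∃ G : Set (Fin n → Y), MeasurableSet G ∧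
      ∀ x₁ x₂, ∑ i, c₁ (x₁ i) ≤ Γ₁ n → ∑ i, c₂ (x₂ i) ≤ Γ₂ n →
        blockOutput W x₁ x₂ Gᶜ ≤ η ∧
        ∀ x₁' x₂', ∑ i, c₁ (x₁' i) ≤ Γ₁ n → ∑ i, c₂ (x₂' i) ≤ Γ₂ n →
          (blockOutput W x₁ x₂).restrict G ≤
            ENNReal.ofReal (Real.exp (n * δ)) • blockOutput W x₁' x₂'

lemma tendsto_ofReal_exp_neg_mul {δ : ℝ} (hδ : 0 < δ) :
    Tendsto (fun n : ℕ ↦ ENNReal.ofReal (Real.exp (-(n * δ)))) atTop (𝓝 0) := by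
  rw [← ENNReal.ofReal_zero]
  exact ENNReal.tendsto_ofReal (Real.tendsto_exp_neg_atTop_nhds_zero.comp
    (tendsto_natCast_atTop_atTop.atTop_mul_const hδ))

lemma ofReal_exp_mul_mul_mul_le {a b c : ℝ} {β : ℝ≥0∞} (hβ : β ≤ ENNReal.ofReal (Real.exp c)) :
    ENNReal.ofReal (Real.exp a) * (ENNReal.ofReal (Real.exp b) * (ENNReal.ofReal (Real.exp a) * β))
      ≤ ENNReal.ofReal (Real.exp (2 * a + b + c)) := by
  calc _ ≤ ENNReal.ofReal (Real.exp a) * (ENNReal.ofReal (Real.exp b) *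
          (ENNReal.ofReal (Real.exp a) * ENNReal.ofReal (Real.exp c))) := by gcongr
    _ = ENNReal.ofReal (Real.exp (2 * a + b + c)) := by
        simp only [← ENNReal.ofReal_mul (Real.exp_nonneg _), ← Real.exp_add]
        congr 2
        ring

lemma eventually_le_ofReal_exp_of_le_liminf {β : ℕ → ℝ≥0∞}
    (hβ : (θ : EReal) ≤ liminf (fun n ↦ -ENNReal.log (β n) / (n : EReal)) atTop) {τ : ℝ}
    (hτ : τ < θ) : ∀ᶠ n in atTop, β n ≤ ENNReal.ofReal (Real.exp (-(n * τ))) := by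
  filter_upwards [eventually_lt_of_lt_liminf ((EReal.coe_lt_coe_iff.2 hτ).trans_le hβ),
    eventually_gt_atTop 0] with n hlt hn
  exact (coe_le_neg_log_div_iff hn).1 hlt.le

lemma IsAsymptoticallyBlind.eventually_one_le (hW : IsAsymptoticallyBlind W c₁ c₂ Γ₁ Γ₂)
    {S : ∀ n, Scheme U₁ U₂ V X₁ X₂ Y n}
    (hcost : ∀ n, 1 ≤ n → (S n).MeetsCost c₁ c₂ (Γ₁ n) (Γ₂ n))
    (hβ : (θ : EReal) ≤ liminf (fun n ↦ -ENNReal.log ((S n).typeII Q W) / (n : EReal)) atTop)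
    (hθ : klDiv (marginalV P) (marginalV Q) < ENNReal.ofReal θ) {η : ℝ≥0∞} (hη : 0 < η) :
    ∀ᶠ n in atTop, 1 ≤ (S n).typeI P W + η := by
  obtain ⟨τ, -, hτ, hτθ⟩ := ENNReal.lt_iff_exists_real_btwn.1 hθ
  replace hτθ : τ < θ := (ENNReal.ofReal_lt_ofReal_iff'.1 hτθ).1
  let δ := (θ - τ) / 4
  have hδ : 0 < δ := by simp only [δ]; linarith
  obtain ⟨T, hT, hTlim, hTle⟩ := exists_restrict_pi_le_smul_of_klDiv_lt hτ
  have hrest := (tendsto_ofReal_exp_neg_mul hδ).add hTlim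
  rw [add_zero] at hrest
  filter_upwards [hW δ hδ (η / 2) (ENNReal.half_pos hη.ne'),
    hrest.eventually_le_const (ENNReal.half_pos hη.ne'),
    eventually_le_ofReal_exp_of_le_liminf hβ (sub_lt_self θ hδ), eventually_ge_atTop 1]
    with n ⟨G, hG, hblind⟩ hrest hβ hn
  have hblind' (u : Fin n → U₁ × U₂ × V) :=
    hblind _ _ ((hcost n hn).1 fun i ↦ (u i).1) ((hcost n hn).2 fun i ↦ (u i).2.1)
  have hexp := ofReal_exp_mul_mul_mul_le (a := n * δ) (b := n * τ) hβ
  rw [show 2 * (n * δ) + n * τ + -(n * (θ - δ)) = -(n * δ) by simp only [δ]; ring] at hexp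
  calc 1 ≤ (S n).typeI P W + _ + η / 2 + _ :=
        (S n).one_le_typeI_add_mul_typeII hG (hT n) (fun u ↦ (hblind' u).1)
          (fun u _ ↦ (hblind' u).2 _ _ ((hcost n hn).1 _) ((hcost n hn).2 _)) (hTle n)
    _ ≤ (S n).typeI P W + (ENNReal.ofReal (Real.exp (-(n * δ))) +
          Measure.pi (fun _ ↦ marginalV P) (T n)ᶜ) + η / 2 := by
        rw [← add_assoc, add_right_comm _ (η / 2)]
        gcongr
    _ ≤ (S n).typeI P W + η / 2 + η / 2 := by gcongr
    _ = (S n).typeI P W + η := by rw [add_assoc, ENNReal.add_halves]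

lemma IsAchievable.ofReal_le_klDiv (hε : ε < 1) (hW : IsAsymptoticallyBlind W c₁ c₂ Γ₁ Γ₂)
    (hθ : IsAchievable P Q W c₁ c₂ Γ₁ Γ₂ ε θ) :
    ENNReal.ofReal θ ≤ klDiv (marginalV P) (marginalV Q) := by
  obtain ⟨-, S, hcost, hα, hβ⟩ := hθ
  by_contra! hlt
  obtain ⟨a, hεa, ha⟩ := exists_between (ENNReal.ofReal_lt_one.2 hε)
  have hsmall := eventually_lt_of_limsup_lt (hα.trans_lt hεa)
  obtain ⟨n, hn, hn'⟩ := (hsmall.and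
    (hW.eventually_one_le hcost hβ hlt (tsub_pos_of_lt ha))).exists
  refine hn'.not_gt ?_
  calc (S n).typeI P W + (1 - a) < a + (1 - a) := ENNReal.add_lt_add_right (by finiteness) hn
    _ = 1 := add_tsub_cancel_of_le ha.le

/-! ### Achievability -/

lemma isAchievable_of_lt_klDiv {x₁ : ∀ n, Fin n → X₁} {x₂ : ∀ n, Fin n → X₂}
    (hx₁ : ∀ n, 1 ≤ n → ∑ i, c₁ (x₁ n i) ≤ Γ₁ n) (hx₂ : ∀ n, 1 ≤ n → ∑ i, c₂ (x₂ n i) ≤ Γ₂ n)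
    (hθ₀ : 0 < θ) (hθ : ENNReal.ofReal θ < klDiv (marginalV P) (marginalV Q)) :
    IsAchievable P Q W c₁ c₂ Γ₁ Γ₂ ε θ := by
  classical
  obtain ⟨T, hT, hμ, hν⟩ := exists_measure_pi_le_exp_of_lt_klDiv hθ
  let S (n : ℕ) : Scheme U₁ U₂ V X₁ X₂ Y n :=
    Scheme.constant (x₁ n) (x₂ n) (fun z ↦ if z.2 ∈ T n then 0 else 1)
      (Measurable.ite (measurable_snd (hT n)) measurable_const measurable_const)
  have htypeI (n : ℕ) : (S n).typeI P W = Measure.pi (fun _ ↦ marginalV P) (T n)ᶜ := by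
    rw [← (S n).law_snd_preimage (W := W) (hT n).compl, Scheme.typeI]
    congr 1
    ext z
    simp [S, Scheme.constant]
  have htypeII (n : ℕ) : (S n).typeII Q W = Measure.pi (fun _ ↦ marginalV Q) (T n) := by
    rw [← (S n).law_snd_preimage (W := W) (hT n), Scheme.typeII]
    congr 1
    ext z
    simp [S, Scheme.constant]
  refine ⟨hθ₀, S, fun n hn ↦ ⟨fun _ ↦ hx₁ n hn, fun _ ↦ hx₂ n hn⟩, ?_, ?_⟩
  · simp only [htypeI, hμ.limsup_eq, zero_le]
  · refine le_liminf_of_le (by isBoundedDefault) ?_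
    filter_upwards [eventually_gt_atTop 0] with n hn
    exact (coe_le_neg_log_div_iff hn).2 ((htypeII n).trans_le (hν n))

theorem steinExponent_eq_klDiv_marginalV (hε : ε < 1)
    (hW : IsAsymptoticallyBlind W c₁ c₂ Γ₁ Γ₂) {x₁ : ∀ n, Fin n → X₁} {x₂ : ∀ n, Fin n → X₂}
    (hx₁ : ∀ n, 1 ≤ n → ∑ i, c₁ (x₁ n i) ≤ Γ₁ n) (hx₂ : ∀ n, 1 ≤ n → ∑ i, c₂ (x₂ n i) ≤ Γ₂ n) :
    steinExponent P Q W c₁ c₂ Γ₁ Γ₂ ε = klDiv (marginalV P) (marginalV Q) := by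
  refine le_antisymm (iSup₂_le fun θ hθ ↦ hθ.ofReal_le_klDiv hε hW)
    (le_of_forall_lt fun c hc ↦ ?_)
  obtain ⟨θ, -, hcθ, hθ⟩ := ENNReal.lt_iff_exists_real_btwn.1 hc
  have hθ₀ : 0 < θ := ENNReal.ofReal_pos.1 (zero_le.trans_lt hcθ)
  exact hcθ.trans_le (le_iSup₂ (f := fun (τ : ℝ) (_ : IsAchievable P Q W c₁ c₂ Γ₁ Γ₂ ε τ) ↦
    ENNReal.ofReal τ) θ (isAchievable_of_lt_klDiv hx₁ hx₂ hθ₀ hθ))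

end Stein

/-! ### Perturbation of the `p`-th power cost -/

section PowerCost

variable {p : ℝ}

lemma abs_add_rpow_le (hp : 0 < p) (a b : ℝ) : |a + b| ^ p ≤ 2 ^ p * (|a| ^ p + |b| ^ p) := by
  wlog hab : |a| ≤ |b| generalizing a b
  · rw [add_comm a, add_comm (|a| ^ p)]
    exact this b a (le_of_not_ge hab)
  calc |a + b| ^ p ≤ (2 * |b|) ^ p := by
        gcongr
        linarith [abs_add_le a b]
    _ = 2 ^ p * |b| ^ p := Real.mul_rpow zero_le_two (abs_nonneg _)
    _ ≤ 2 ^ p * (|a| ^ p + |b| ^ p) := by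
        gcongr
        exact le_add_of_nonneg_left (by positivity)

lemma exists_abs_rpow_sub_le_of_abs_le_mul (hp : 0 < p) {η : ℝ} (hη : 0 < η) :
    ∃ r > 0, ∀ y a : ℝ, |a| ≤ r * |y| → |(|y - a| ^ p - |y| ^ p)| ≤ η * |y| ^ p := by
  have hcont : ContinuousAt (fun t : ℝ ↦ |1 - t| ^ p) 0 :=
    ContinuousAt.rpow_const (by fun_prop) (Or.inr hp.le)
  obtain ⟨r, hr, h⟩ := Metric.nhds_basis_closedBall.eventually_iff.1
    (hcont.eventually (Metric.closedBall_mem_nhds _ hη))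
  refine ⟨r, hr, fun y a ha ↦ ?_⟩
  rcases eq_or_ne y 0 with rfl | hy
  · obtain rfl : a = 0 := by simpa using ha
    simp [Real.zero_rpow hp.ne']
  have hay : a / y ∈ Metric.closedBall 0 r := by
    rwa [mem_closedBall_zero_iff, Real.norm_eq_abs, abs_div, div_le_iff₀ (abs_pos.2 hy)]
  have hscale : |y - a| ^ p = |y| ^ p * |1 - a / y| ^ p := by
    rw [← Real.mul_rpow (abs_nonneg _) (abs_nonneg _), ← abs_mul, mul_one_sub, mul_div_cancel₀ _ hy]
  have hclose : |(|1 - a / y| ^ p - 1)| ≤ η := by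
    simpa [Real.dist_eq] using h hay
  rw [hscale, ← mul_sub_one, abs_mul, abs_of_nonneg (by positivity), mul_comm]
  gcongr

lemma abs_rpow_sub_le_of_abs_le_mul (hp : 0 < p) {R y a : ℝ} (hR : 0 ≤ R) (h : |y| ≤ R * |a|) :
    |(|y - a| ^ p - |y| ^ p)| ≤ (R + 1) ^ p * |a| ^ p := by
  have hbound {t : ℝ} (ht : |t| ≤ (R + 1) * |a|) : |t| ^ p ≤ (R + 1) ^ p * |a| ^ p := by
    rw [← Real.mul_rpow (by positivity) (abs_nonneg _)]
    gcongr
  exact abs_sub_le_of_nonneg_of_le (by positivity) (hbound (by linarith [abs_sub y a]))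
    (by positivity) (hbound (by linarith [abs_nonneg a]))

lemma exists_abs_rpow_sub_le (hp : 0 < p) {η : ℝ} (hη : 0 < η) :
    ∃ C ≥ 0, ∀ y a : ℝ, |(|y - a| ^ p - |y| ^ p)| ≤ η * |y| ^ p + C * |a| ^ p := by
  obtain ⟨r, hr, hsmall⟩ := exists_abs_rpow_sub_le_of_abs_le_mul hp hη
  refine ⟨(r⁻¹ + 1) ^ p, by positivity, fun y a ↦ ?_⟩
  rcases le_total |a| (r * |y|) with h | h
  · exact (hsmall y a h).trans (le_add_of_nonneg_right (by positivity))
  · have hya : |y| ≤ r⁻¹ * |a| := (le_inv_mul_iff₀ hr).2 h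
    exact (abs_rpow_sub_le_of_abs_le_mul hp (by positivity) hya).trans
      (le_add_of_nonneg_left (by positivity))

lemma exists_sum_abs_sub_rpow_le (hp : 0 < p) {K δ : ℝ} (hK : 0 < K) (hδ : 0 < δ) :
    ∃ κ > 0, ∀ (n : ℕ) (y a b : Fin n → ℝ), ∑ i, |y i| ^ p ≤ n * K → ∑ i, |a i| ^ p ≤ n * κ →
      ∑ i, |b i| ^ p ≤ n * κ → ∑ i, |y i - b i| ^ p ≤ ∑ i, |y i - a i| ^ p + n * δ := by
  obtain ⟨C, hC, h⟩ := exists_abs_rpow_sub_le hp (η := δ / (4 * K)) (by positivity)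
  refine ⟨δ / (4 * (C + 1)), by positivity, fun n y a b hy ha hb ↦ ?_⟩
  have hpoint (i : Fin n) : |y i - b i| ^ p ≤
      |y i - a i| ^ p + 2 * (δ / (4 * K)) * |y i| ^ p + C * (|a i| ^ p + |b i| ^ p) := by
    linarith [(abs_le.1 (h (y i) (a i))).1, (abs_le.1 (h (y i) (b i))).2]
  calc ∑ i, |y i - b i| ^ p
      ≤ ∑ i, |y i - a i| ^ p + 2 * (δ / (4 * K)) * ∑ i, |y i| ^ p +
          C * (∑ i, |a i| ^ p + ∑ i, |b i| ^ p) := by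
        simp only [Finset.mul_sum, ← Finset.sum_add_distrib]
        exact Finset.sum_le_sum fun i _ ↦ hpoint i
    _ ≤ ∑ i, |y i - a i| ^ p + 2 * (δ / (4 * K)) * (n * K) +
          (C + 1) * (n * (δ / (4 * (C + 1))) + n * (δ / (4 * (C + 1)))) := by
        gcongr
        exact le_add_of_nonneg_right zero_le_one
    _ = ∑ i, |y i - a i| ^ p + n * δ := by
        field_simp
        ring

lemma sum_abs_linearCombination_rpow_le (hp : 0 < p) (h₁ h₂ : ℝ) {n : ℕ} (x₁ x₂ : Fin n → ℝ) :
    ∑ i, |h₁ * x₁ i + h₂ * x₂ i| ^ p ≤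
      2 ^ p * (|h₁| ^ p * ∑ i, |x₁ i| ^ p + |h₂| ^ p * ∑ i, |x₂ i| ^ p) := by
  simp only [Finset.mul_sum, ← Finset.sum_add_distrib,
    ← Real.mul_rpow (abs_nonneg _) (abs_nonneg _), ← abs_mul]
  exact Finset.sum_le_sum fun i _ ↦ abs_add_rpow_le hp _ _

lemma eventually_sum_abs_linearCombination_rpow_le (hp : 0 < p) (h₁ h₂ : ℝ) {Γ₁ Γ₂ : ℕ → ℝ}
    (hΓ₁ : Tendsto (fun n : ℕ ↦ Γ₁ n / n) atTop (𝓝 0))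
    (hΓ₂ : Tendsto (fun n : ℕ ↦ Γ₂ n / n) atTop (𝓝 0)) {κ : ℝ} (hκ : 0 < κ) :
    ∀ᶠ n : ℕ in atTop, ∀ x₁ x₂ : Fin n → ℝ, ∑ i, |x₁ i| ^ p ≤ Γ₁ n → ∑ i, |x₂ i| ^ p ≤ Γ₂ n →
      ∑ i, |h₁ * x₁ i + h₂ * x₂ i| ^ p ≤ n * κ := by
  have hlim : Tendsto (fun n : ℕ ↦ 2 ^ p * (|h₁| ^ p * (Γ₁ n / n) + |h₂| ^ p * (Γ₂ n / n)))
      atTop (𝓝 0) := by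
    simpa using ((hΓ₁.const_mul (|h₁| ^ p)).add (hΓ₂.const_mul (|h₂| ^ p))).const_mul (2 ^ p)
  filter_upwards [hlim.eventually_le_const hκ, eventually_gt_atTop 0] with n hn hn₀ x₁ x₂ hx₁ hx₂
  calc ∑ i, |h₁ * x₁ i + h₂ * x₂ i| ^ p
      ≤ 2 ^ p * (|h₁| ^ p * Γ₁ n + |h₂| ^ p * Γ₂ n) :=
        (sum_abs_linearCombination_rpow_le hp h₁ h₂ x₁ x₂).trans (by gcongr)
    _ = n * (2 ^ p * (|h₁| ^ p * (Γ₁ n / n) + |h₂| ^ p * (Γ₂ n / n))) := by field_simp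
    _ ≤ n * κ := by gcongr

end PowerCost

/-! ### Shifted noise blocks -/

lemma map_const_add_withDensity {f : ℝ → ℝ≥0∞} (hf : Measurable f) (c : ℝ) :
    (volume.withDensity f).map (c + ·) = volume.withDensity fun y ↦ f (y - c) := by
  ext s hs
  rw [Measure.map_apply (by fun_prop) hs, withDensity_apply _ hs,
    withDensity_apply _ (measurable_const_add c hs),
    ← (measurePreserving_add_left volume c).setLIntegral_comp_preimage hs (by fun_prop)]
  simp only [add_sub_cancel_left]

/-- Law of the block `a^n + Z^n`, where the `Z_i` are i.i.d. with law `ν`. -/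
noncomputable def shiftedNoise (ν : Measure ℝ) {n : ℕ} (a : Fin n → ℝ) : Measure (Fin n → ℝ) :=
  Measure.pi fun i ↦ ν.map (a i + ·)

section ShiftedNoise

variable {ν : Measure ℝ} [IsProbabilityMeasure ν]

instance isProbabilityMeasure_map_const_add (c : ℝ) : IsProbabilityMeasure (ν.map (c + ·)) :=
  Measure.isProbabilityMeasure_map (by fun_prop)

instance isMarkovKernel_additiveMAC (h₁ h₂ : ℝ) : IsMarkovKernel (additiveMAC h₁ h₂ ν) :=
  ⟨fun x ↦ isProbabilityMeasure_map_const_add (h₁ * x.1 + h₂ * x.2)⟩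

lemma blockOutput_additiveMAC (ν : Measure ℝ) [SFinite ν] (h₁ h₂ : ℝ) {n : ℕ} (x₁ x₂ : Fin n → ℝ) :
    blockOutput (additiveMAC h₁ h₂ ν) x₁ x₂ = shiftedNoise ν fun i ↦ h₁ * x₁ i + h₂ * x₂ i :=
  rfl

lemma shiftedNoise_withDensity {f : ℝ → ℝ≥0∞} (hf : Measurable f)
    [IsProbabilityMeasure (volume.withDensity f)] {n : ℕ} (a : Fin n → ℝ) :
    shiftedNoise (volume.withDensity f) a = volume.withDensity fun y ↦ ∏ i, f (y i - a i) := by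
  have (i : Fin n) : IsProbabilityMeasure (volume.withDensity fun y ↦ f (y - a i)) := by
    rw [← map_const_add_withDensity hf]
    infer_instance
  simp only [shiftedNoise, map_const_add_withDensity hf]
  exact pi_withDensity _ fun i ↦ by fun_prop

lemma lintegral_abs_const_add_rpow_le {p : ℝ} (hp : 0 < p) (c : ℝ) :
    ∫⁻ z, ENNReal.ofReal (|c + z| ^ p) ∂ν ≤
      ENNReal.ofReal (2 ^ p) * (ENNReal.ofReal (|c| ^ p) + ∫⁻ z, ENNReal.ofReal (|z| ^ p) ∂ν) := by
  calc ∫⁻ z, ENNReal.ofReal (|c + z| ^ p) ∂ν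
      ≤ ∫⁻ z, ENNReal.ofReal (2 ^ p) *
          (ENNReal.ofReal (|c| ^ p) + ENNReal.ofReal (|z| ^ p)) ∂ν := by
        refine lintegral_mono fun z ↦ ?_
        rw [← ENNReal.ofReal_add (by positivity) (by positivity),
          ← ENNReal.ofReal_mul (by positivity)]
        exact ENNReal.ofReal_le_ofReal (abs_add_rpow_le hp c z)
    _ = ENNReal.ofReal (2 ^ p) *
          (ENNReal.ofReal (|c| ^ p) + ∫⁻ z, ENNReal.ofReal (|z| ^ p) ∂ν) := by
        rw [lintegral_const_mul' _ _ ENNReal.ofReal_ne_top, lintegral_add_left measurable_const,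
          lintegral_const, measure_univ, mul_one]

lemma lintegral_sum_abs_rpow_shiftedNoise_le {p : ℝ} (hp : 0 < p) {n : ℕ} (a : Fin n → ℝ) :
    ∫⁻ y, ENNReal.ofReal (∑ i, |y i| ^ p) ∂shiftedNoise ν a ≤
      ENNReal.ofReal (2 ^ p) *
        (ENNReal.ofReal (∑ i, |a i| ^ p) + n * ∫⁻ z, ENNReal.ofReal (|z| ^ p) ∂ν) := by
  have hcoord (i : Fin n) : ∫⁻ y, ENNReal.ofReal (|y i| ^ p) ∂shiftedNoise ν a =
      ∫⁻ z, ENNReal.ofReal (|a i + z| ^ p) ∂ν := by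
    rw [← lintegral_map (by fun_prop : Measurable fun t : ℝ ↦ ENNReal.ofReal (|t| ^ p))
      (measurable_const_add (a i))]
    exact (measurePreserving_eval (fun i ↦ ν.map (a i + ·)) i).lintegral_comp
      (by fun_prop : Measurable fun t : ℝ ↦ ENNReal.ofReal (|t| ^ p))
  simp only [ENNReal.ofReal_sum_of_nonneg fun _ _ ↦ Real.rpow_nonneg (abs_nonneg _) p]
  rw [lintegral_finsetSum _ fun i _ ↦ by fun_prop]
  calc ∑ i, ∫⁻ y, ENNReal.ofReal (|y i| ^ p) ∂shiftedNoise ν a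
      ≤ ∑ i, ENNReal.ofReal (2 ^ p) *
          (ENNReal.ofReal (|a i| ^ p) + ∫⁻ z, ENNReal.ofReal (|z| ^ p) ∂ν) :=
        Finset.sum_le_sum fun i _ ↦ (hcoord i).trans_le (lintegral_abs_const_add_rpow_le hp _)
    _ = _ := by
        rw [← Finset.mul_sum, Finset.sum_add_distrib, Finset.sum_const, Finset.card_univ,
          Fintype.card_fin, nsmul_eq_mul]

lemma exists_shiftedNoise_lt_sum_abs_rpow_le {p : ℝ} (hp : 0 < p)
    (hν : ∫⁻ z, ENNReal.ofReal (|z| ^ p) ∂ν ≠ ∞) {η : ℝ≥0∞} (hη : 0 < η) :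
    ∃ K : ℝ, 0 < K ∧ ∀ (n : ℕ) (a : Fin n → ℝ), 0 < n → ∑ i, |a i| ^ p ≤ n →
      shiftedNoise ν a {y | n * K < ∑ i, |y i| ^ p} ≤ η := by
  set M := ∫⁻ z, ENNReal.ofReal (|z| ^ p) ∂ν
  obtain ⟨K, hK⟩ := ENNReal.exists_nat_gt
    (ENNReal.div_ne_top (by finiteness : ENNReal.ofReal (2 ^ p) * (1 + M) ≠ ∞) hη.ne')
  have hK₀ : 0 < K := Nat.pos_of_ne_zero fun h ↦ by simp [h] at hK
  refine ⟨K, by positivity, fun n a hn ha ↦ ?_⟩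
  have hmean : ∫⁻ y, ENNReal.ofReal (∑ i, |y i| ^ p) ∂shiftedNoise ν a ≤ η * (n * K) := by
    calc _ ≤ ENNReal.ofReal (2 ^ p) * (n + n * M) :=
          (lintegral_sum_abs_rpow_shiftedNoise_le hp a).trans
            (by gcongr; exact ENNReal.ofReal_le_of_le_toReal (by simpa using ha))
      _ = n * (ENNReal.ofReal (2 ^ p) * (1 + M)) := by ring
      _ ≤ n * (η * K) := by
          refine mul_le_mul' le_rfl ?_
          rw [mul_comm η]
          exact (ENNReal.div_le_iff_le_mul (.inl hη.ne') (.inr (by positivity))).1 hK.le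
      _ = η * (n * K) := by ring
  calc shiftedNoise ν a {y | n * K < ∑ i, |y i| ^ p}
      ≤ shiftedNoise ν a {y | (n * K : ℝ≥0∞) ≤ ENNReal.ofReal (∑ i, |y i| ^ p)} :=
        measure_mono fun y (hy : (n * K : ℝ) < _) ↦ by
          have := ENNReal.ofReal_le_ofReal hy.le
          rwa [ENNReal.ofReal_mul (by positivity), ENNReal.ofReal_natCast,
            ENNReal.ofReal_natCast] at this
    _ ≤ (∫⁻ y, ENNReal.ofReal (∑ i, |y i| ^ p) ∂shiftedNoise ν a) / (n * K) :=
        meas_ge_le_lintegral_div (by fun_prop : Measurable _).aemeasurable (by positivity)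
          (by finiteness)
    _ ≤ η := ENNReal.div_le_of_le_mul hmean

end ShiftedNoise

/-! ### Generalized Gaussian noise -/

section GenGaussian

variable {p σ : ℝ}

@[fun_prop]
lemma measurable_genGaussianPDF (p σ : ℝ) : Measurable (genGaussianPDF p σ) := by
  unfold genGaussianPDF
  fun_prop

lemma genGaussianPDF_pos (hp : 0 < p) (hσ : 0 < σ) (z : ℝ) : 0 < genGaussianPDF p σ z := by
  have := Real.Gamma_pos_of_pos (one_div_pos.2 hp)
  unfold genGaussianPDF
  positivity

lemma genGaussianPDF_eq_mul_exp_neg_mul (p σ z : ℝ) :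
    genGaussianPDF p σ z = p / ((2 : ℝ) ^ ((p + 1) / p) * Real.Gamma (1 / p)) / σ *
      Real.exp (-(1 / (2 * σ ^ p)) * |z| ^ p) := by
  rw [genGaussianPDF, neg_mul, one_div_mul_eq_div]

lemma integrable_abs_rpow_mul_exp_neg_mul {q b : ℝ} (hp : 0 < p) (hq : -1 < q) (hb : 0 < b) :
    Integrable fun z : ℝ ↦ |z| ^ q * Real.exp (-b * |z| ^ p) := by
  refine Integrable.of_integral_ne_zero ?_
  rw [integral_comp_abs (f := fun z : ℝ ↦ z ^ q * Real.exp (-b * z ^ p)),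
    integral_rpow_mul_exp_neg_mul_rpow hp hq hb]
  have := Real.Gamma_pos_of_pos (div_pos (neg_lt_iff_pos_add.1 hq) hp)
  positivity

lemma integral_exp_neg_mul_abs_rpow {b : ℝ} (hp : 0 < p) (hb : 0 < b) :
    ∫ z : ℝ, Real.exp (-b * |z| ^ p) = 2 * (b ^ (-1 / p) * Real.Gamma (1 / p + 1)) := by
  rw [integral_comp_abs (f := fun z : ℝ ↦ Real.exp (-b * z ^ p)), integral_exp_neg_mul_rpow hp hb]

lemma integral_genGaussianPDF (hp : 0 < p) (hσ : 0 < σ) : ∫ z, genGaussianPDF p σ z = 1 := by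
  have := Real.Gamma_pos_of_pos (one_div_pos.2 hp)
  have hscale : (1 / (2 * σ ^ p)) ^ (-1 / p) = 2 ^ (1 / p) * σ := by
    rw [one_div, Real.inv_rpow (by positivity), ← Real.rpow_neg (by positivity), neg_div, neg_neg,
      Real.mul_rpow (by positivity) (by positivity), ← Real.rpow_mul hσ.le,
      mul_one_div_cancel hp.ne', Real.rpow_one]
  have hpow : (2 : ℝ) ^ ((p + 1) / p) = 2 * 2 ^ (1 / p) := by
    rw [add_div, div_self hp.ne', Real.rpow_one_add' (by positivity) (by positivity)]
  simp only [genGaussianPDF_eq_mul_exp_neg_mul]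
  rw [integral_const_mul, integral_exp_neg_mul_abs_rpow hp (by positivity), hscale, hpow,
    Real.Gamma_add_one (one_div_pos.2 hp).ne']
  field_simp

lemma isProbabilityMeasure_genGaussian (hp : 0 < p) (hσ : 0 < σ) :
    IsProbabilityMeasure (genGaussian p σ) := by
  have hint : Integrable (genGaussianPDF p σ) :=
    .of_integral_ne_zero (by rw [integral_genGaussianPDF hp hσ]; exact one_ne_zero)
  refine ⟨?_⟩
  rw [genGaussian, withDensity_apply _ MeasurableSet.univ, Measure.restrict_univ,
    ← ofReal_integral_eq_lintegral_ofReal hint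
      (ae_of_all _ fun z ↦ (genGaussianPDF_pos hp hσ z).le),
    integral_genGaussianPDF hp hσ, ENNReal.ofReal_one]

lemma integrable_abs_rpow_genGaussian (hp : 0 < p) (hσ : 0 < σ) :
    Integrable (fun z : ℝ ↦ |z| ^ p) (genGaussian p σ) := by
  rw [genGaussian, integrable_withDensity_iff (measurable_genGaussianPDF p σ).ennreal_ofReal
    (ae_of_all _ fun _ ↦ ENNReal.ofReal_lt_top)]
  simp_rw [ENNReal.toReal_ofReal (genGaussianPDF_pos hp hσ _).le,
    genGaussianPDF_eq_mul_exp_neg_mul, mul_left_comm (|_| ^ p)]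
  exact (integrable_abs_rpow_mul_exp_neg_mul hp (neg_one_lt_zero.trans hp)
    (by positivity)).const_mul _

lemma prod_genGaussianPDF_le_mul (hp : 0 < p) (hσ : 0 < σ) {n : ℕ} {y z : Fin n → ℝ} {B : ℝ}
    (h : ∑ i, |z i| ^ p ≤ ∑ i, |y i| ^ p + B) :
    ∏ i, genGaussianPDF p σ (y i) ≤
      Real.exp (B / (2 * σ ^ p)) * ∏ i, genGaussianPDF p σ (z i) := by
  have := Real.Gamma_pos_of_pos (one_div_pos.2 hp)
  simp_rw [genGaussianPDF, Finset.prod_mul_distrib, ← Real.exp_sum, Finset.sum_neg_distrib,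
    ← Finset.sum_div]
  rw [mul_left_comm, ← Real.exp_add, ← sub_eq_add_neg, ← sub_div]
  refine mul_le_mul_of_nonneg_left (Real.exp_le_exp.2 ?_)
    (Finset.prod_nonneg fun i _ ↦ by positivity)
  rw [← neg_div]
  gcongr
  linarith

lemma restrict_shiftedNoise_genGaussian_le_smul (hp : 0 < p) (hσ : 0 < σ) {n : ℕ}
    {a b : Fin n → ℝ} {G : Set (Fin n → ℝ)} (hG : MeasurableSet G) {B : ℝ}
    (h : ∀ y ∈ G, ∑ i, |y i - b i| ^ p ≤ ∑ i, |y i - a i| ^ p + B) :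
    (shiftedNoise (genGaussian p σ) a).restrict G ≤
      ENNReal.ofReal (Real.exp (B / (2 * σ ^ p))) • shiftedNoise (genGaussian p σ) b := by
  have := isProbabilityMeasure_genGaussian hp hσ
  have hPDF := (measurable_genGaussianPDF p σ).ennreal_ofReal
  unfold genGaussian at this ⊢
  rw [shiftedNoise_withDensity hPDF, shiftedNoise_withDensity hPDF]
  refine restrict_withDensity_le_smul (by fun_prop) hG (ae_of_all _ fun y hy ↦ ?_)
  simp only [← ENNReal.ofReal_prod_of_nonneg fun _ _ ↦ (genGaussianPDF_pos hp hσ _).le]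
  rw [← ENNReal.ofReal_mul (Real.exp_nonneg _)]
  exact ENNReal.ofReal_le_ofReal (prod_genGaussianPDF_le_mul hp hσ (h y hy))

lemma isAsymptoticallyBlind_additiveMAC_genGaussian (hp : 0 < p) (hσ : 0 < σ) (h₁ h₂ : ℝ)
    {Γ₁ Γ₂ : ℕ → ℝ} (hΓ₁ : Tendsto (fun n : ℕ ↦ Γ₁ n / n) atTop (𝓝 0))
    (hΓ₂ : Tendsto (fun n : ℕ ↦ Γ₂ n / n) atTop (𝓝 0)) :
    IsAsymptoticallyBlind (additiveMAC h₁ h₂ (genGaussian p σ)) (|·| ^ p) (|·| ^ p) Γ₁ Γ₂ := by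
  intro δ hδ η hη
  have := isProbabilityMeasure_genGaussian hp hσ
  obtain ⟨K, hK, htail⟩ := exists_shiftedNoise_lt_sum_abs_rpow_le hp
    (integrable_abs_rpow_genGaussian hp hσ).lintegral_lt_top.ne hη
  obtain ⟨κ, hκ, hcompare⟩ := exists_sum_abs_sub_rpow_le hp hK
    (by positivity : 0 < δ * (2 * σ ^ p))
  filter_upwards [eventually_gt_atTop 0,
    eventually_sum_abs_linearCombination_rpow_le hp h₁ h₂ hΓ₁ hΓ₂ one_pos,
    eventually_sum_abs_linearCombination_rpow_le hp h₁ h₂ hΓ₁ hΓ₂ hκ] with n hn hone hsmall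
  have hG : MeasurableSet {y : Fin n → ℝ | ∑ i, |y i| ^ p ≤ n * K} :=
    measurableSet_le (by fun_prop) measurable_const
  refine ⟨_, hG, fun x₁ x₂ hx₁ hx₂ ↦ ⟨?_, fun x₁' x₂' hx₁' hx₂' ↦ ?_⟩⟩
  · rw [blockOutput_additiveMAC, Set.compl_ofPred]
    simpa only [not_le] using htail n _ hn (by simpa using hone x₁ x₂ hx₁ hx₂)
  · have hexp : n * δ = n * (δ * (2 * σ ^ p)) / (2 * σ ^ p) := by field_simp
    rw [blockOutput_additiveMAC, blockOutput_additiveMAC, hexp]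
    exact restrict_shiftedNoise_genGaussian_le_smul hp hσ hG fun y hy ↦
      hcompare n y _ _ hy (hsmall x₁ x₂ hx₁ hx₂) (hsmall x₁' x₂' hx₁' hx₂')

end GenGaussian

end SublinearMAC

theorem theorem2_general {U₁ U₂ V : Type*}
    [Countable U₁] [MeasurableSpace U₁] [MeasurableSingletonClass U₁]
    [Countable U₂] [MeasurableSpace U₂] [MeasurableSingletonClass U₂] [MeasurableSpace V]
    (P Q : Measure (U₁ × U₂ × V)) [IsProbabilityMeasure P] [IsProbabilityMeasure Q]
    (h₁ h₂ : ℝ) (p σ : ℝ) (hp : 0 < p) (hσ : 0 < σ) (ε : ℝ) (hε : ε ∈ Set.Ico 0 1)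
    (Γ₁ Γ₂ : ℕ → ℝ) (hΓ₁_nonneg : ∀ n, 1 ≤ n → 0 ≤ Γ₁ n) (hΓ₂_nonneg : ∀ n, 1 ≤ n → 0 ≤ Γ₂ n)
    (hΓ₁ : Tendsto (fun n : ℕ ↦ Γ₁ n / n) atTop (𝓝 0))
    (hΓ₂ : Tendsto (fun n : ℕ ↦ Γ₂ n / n) atTop (𝓝 0)) :
    SublinearMAC.steinExponent P Q
        (SublinearMAC.additiveMAC h₁ h₂ (SublinearMAC.genGaussian p σ))
        (fun x : ℝ ↦ |x| ^ p) (fun x : ℝ ↦ |x| ^ p) Γ₁ Γ₂ ε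
      = InformationTheory.klDiv (SublinearMAC.marginalV P) (SublinearMAC.marginalV Q) := by
  have := SublinearMAC.isProbabilityMeasure_genGaussian hp hσ
  have hzero (n : ℕ) : ∑ _i : Fin n, |(0 : ℝ)| ^ p = 0 := by simp [Real.zero_rpow hp.ne']
  exact SublinearMAC.steinExponent_eq_klDiv_marginalV hε.2
    (SublinearMAC.isAsymptoticallyBlind_additiveMAC_genGaussian hp hσ h₁ h₂ hΓ₁ hΓ₂)
    (x₁ := fun _ _ ↦ 0) (x₂ := fun _ _ ↦ 0)
    (fun n hn ↦ (hzero n).trans_le (hΓ₁_nonneg n hn))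
    (fun n hn ↦ (hzero n).trans_le (hΓ₂_nonneg n hn))

theorem theorem2 {U₁ U₂ V : Type*}
    [Fintype U₁] [MeasurableSpace U₁] [MeasurableSingletonClass U₁]
    [Fintype U₂] [MeasurableSpace U₂] [MeasurableSingletonClass U₂]
    [Fintype V] [MeasurableSpace V] [MeasurableSingletonClass V]
    (P Q : Measure (U₁ × U₂ × V)) [IsProbabilityMeasure P] [IsProbabilityMeasure Q]
    (hPQ : P ≪ Q)
    (h₁ h₂ : ℝ) (hh₁ : h₁ ≠ 0) (hh₂ : h₂ ≠ 0)
    (p σ : ℝ) (hp : 0 < p) (hσ : 0 < σ)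
    (ε : ℝ) (hε₀ : 0 ≤ ε) (hε₁ : ε < 1)
    (Γ₁ Γ₂ : ℕ → ℝ) (hΓ₁ : SublinearMAC.IsStringentBudget Γ₁)
    (hΓ₂ : SublinearMAC.IsStringentBudget Γ₂) :
    SublinearMAC.steinExponent P Q
        (SublinearMAC.additiveMAC h₁ h₂ (SublinearMAC.genGaussian p σ))
        (fun x : ℝ => |x| ^ p) (fun x : ℝ => |x| ^ p) Γ₁ Γ₂ ε
      = InformationTheory.klDiv (SublinearMAC.marginalV P) (SublinearMAC.marginalV Q) := by
  exact theorem2_general P Q h₁ h₂ p σ hp hσ ε ⟨hε₀, hε₁⟩ Γ₁ Γ₂ hΓ₁.nonneg hΓ₂.nonneg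
    hΓ₁.sublinear hΓ₂.sublinear
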